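/- Let $n\ge 0$ be an integer. Let $GVB_n$ (the virtual Gauss braid group on $n$ strands) be the group with generators $s_1,\dots,s_{n-1},\rho_1,\dots,\rho_{n-1}$ and defining relations \begin{align*} & s_is_{i+1}s_i=s_{i+1}s_is_{i+1},\quad \rho_i\rho_{i+1}\rho_i=\rho_{i+1}\rho_i\rho_{i+1},\quad \rho_i\rho_{i+1}s_i=s_{i+1}\rho_i\rho_{i+1} && (1\le i\le n-2),\\ & s_is_j=s_js_i,\quad \rho_i\rho_j=\rho_j\rho_i,\quad s_i\rho_j=\rho_js_i && (|i-j|\ge 2),\\ & s_i^2=1,\quad \rho_i^2=1,\quad s_i\rho_i=\rho_is_i && (1\le i\le n-1). \end{align*} Let $\mu\colon GVB_n\to S_n$ be the homomorphism with $\mu(s_i)=1$ and $\mu(\rho_i)=(i,i+1)$, and let $GH_n=\ker\mu$. Then: 1. $GVB_n$ is linear, that is, for some field $K$ and some $d\ge 0$ there is an injective homomorphism $GVB_n\to GL_d(K)$; 2. $\mu$ has a section $\iota\colon S_n\to GVB_n$ with $\iota((i,i+1))=\rho_i$ for all $i$, and $GVB_n=GH_n\rtimes S_n$, where $S_n$ acts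 on $GH_n$ by conjugation through $\iota$; 3. $GH_n$ is a finitely generated Coxeter group, that is, it has a Coxeter system with finitely many simple reflections; 4. $GH_n$ has finite index in $GVB_n$. -/

import Mathlib

namespace GaussBraid

/-- Generators `σ₁, …, σ_{n-1}, ρ₁, …, ρ_{n-1}` of the virtual braid group on `n` strands
(indexed from `0` here, so that the `i`-th one involves the strands `i` and `i + 1` of `Fin n`). -/
inductive Gen (n : ℕ) : Type
  | sigma (i : Fin (n - 1)) : Gen n
  | rho (i : Fin (n - 1)) : Gen n

/-- The letter `σ_i` in the free group on the generators. -/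
def fs {n : ℕ} (i : Fin (n - 1)) : FreeGroup (Gen n) := FreeGroup.of (Gen.sigma i)

/-- The letter `ρ_i` in the free group on the generators. -/
def fr {n : ℕ} (i : Fin (n - 1)) : FreeGroup (Gen n) := FreeGroup.of (Gen.rho i)

/-- `|i - j| ≥ 2`. -/
def Far {n : ℕ} (i j : Fin (n - 1)) : Prop :=
  (i : ℕ) + 2 ≤ (j : ℕ) ∨ (j : ℕ) + 2 ≤ (i : ℕ)

/-- `j = i + 1`. -/
def Next {n : ℕ} (i j : Fin (n - 1)) : Prop := (j : ℕ) = (i : ℕ) + 1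

/-- The defining relators of the virtual braid group `VB_n`; a relation `u = v` is written as the
relator `u * v⁻¹`. -/
inductive IsVirtualRelator (n : ℕ) : FreeGroup (Gen n) → Prop
  | sigma_braid (i j : Fin (n - 1)) (h : Next i j) :
      IsVirtualRelator n ((fs i * fs j * fs i) * (fs j * fs i * fs j)⁻¹)
  | sigma_comm (i j : Fin (n - 1)) (h : Far i j) :
      IsVirtualRelator n ((fs i * fs j) * (fs j * fs i)⁻¹)
  | rho_braid (i j : Fin (n - 1)) (h : Next i j) :
      IsVirtualRelator n ((fr i * fr j * fr i) * (fr j * fr i * fr j)⁻¹)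
  | rho_comm (i j : Fin (n - 1)) (h : Far i j) :
      IsVirtualRelator n ((fr i * fr j) * (fr j * fr i)⁻¹)
  | rho_sq (i : Fin (n - 1)) : IsVirtualRelator n (fr i ^ 2)
  | sigma_rho_comm (i j : Fin (n - 1)) (h : Far i j) :
      IsVirtualRelator n ((fs i * fr j) * (fr j * fs i)⁻¹)
  | mixed (i j : Fin (n - 1)) (h : Next i j) :
      IsVirtualRelator n ((fr i * fr j * fs i) * (fs j * fr i * fr j)⁻¹)

/-- Relators of `VB_n`. -/
def virtualRelators (n : ℕ) : Set (FreeGroup (Gen n)) := {w | IsVirtualRelator n w}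

/-- Relators of the flat virtual braid group `FVB_n`: those of `VB_n` and `σ_i² = 1`. -/
def flatRelators (n : ℕ) : Set (FreeGroup (Gen n)) :=
  virtualRelators n ∪ Set.range (fun i : Fin (n - 1) => fs i ^ 2)

/-- Relators of the virtual Gauss braid group `GVB_n`: those of `FVB_n` and
`s_i ρ_i = ρ_i s_i`, where `s_i` is the image of `σ_i`. -/
def gaussRelators (n : ℕ) : Set (FreeGroup (Gen n)) :=
  flatRelators n ∪ Set.range (fun i : Fin (n - 1) => (fs i * fr i) * (fr i * fs i)⁻¹)

/-- The virtual Gauss braid group on `n` strands. -/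
abbrev GVB (n : ℕ) : Type := PresentedGroup (gaussRelators n)

/-- The generator `s_i` of `GVB_n`. -/
def s {n : ℕ} (i : Fin (n - 1)) : GVB n := PresentedGroup.of (Gen.sigma i)

/-- The generator `ρ_i` of `GVB_n`. -/
def rho {n : ℕ} (i : Fin (n - 1)) : GVB n := PresentedGroup.of (Gen.rho i)

/-- The adjacent transposition `(i, i+1)` in the symmetric group `S_n`. -/
def adjSwap {n : ℕ} (i : Fin (n - 1)) : Equiv.Perm (Fin n) :=
  Equiv.swap ⟨(i : ℕ), by omega⟩ ⟨(i : ℕ) + 1, by omega⟩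

/-- The assignment `s_i ↦ 1`, `ρ_i ↦ (i, i+1)` on generators. -/
def muGen (n : ℕ) : Gen n → Equiv.Perm (Fin n)
  | Gen.sigma _ => 1
  | Gen.rho i => adjSwap i

theorem adjSwap_mul_self {n : ℕ} (i : Fin (n - 1)) : adjSwap i * adjSwap i = 1 :=
  Equiv.swap_mul_self _ _

theorem adjSwap_comm {n : ℕ} {i j : Fin (n - 1)} (h : Far i j) :
    adjSwap i * adjSwap j = adjSwap j * adjSwap i := by
  ext x
  simp only [adjSwap, Equiv.Perm.mul_apply, Equiv.swap_apply_def, Far] at *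
  grind

theorem adjSwap_braid {n : ℕ} {i j : Fin (n - 1)} (h : Next i j) :
    adjSwap i * adjSwap j * adjSwap i = adjSwap j * adjSwap i * adjSwap j := by
  ext x
  simp only [adjSwap, Equiv.Perm.mul_apply, Equiv.swap_apply_def, Next] at *
  grind

theorem muGen_relators (n : ℕ) :
    ∀ w ∈ gaussRelators n, FreeGroup.lift (muGen n) w = 1 := by
  rintro w ((hw | ⟨i, rfl⟩) | ⟨i, rfl⟩)
  · cases hw with
    | rho_braid i j h =>
      simpa [fr, muGen, mul_inv_eq_one, -mul_inv_rev] using adjSwap_braid h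
    | rho_comm i j h =>
      simpa [fr, muGen, mul_inv_eq_one, -mul_inv_rev] using adjSwap_comm h
    | rho_sq i => simpa [fr, muGen, pow_two] using adjSwap_mul_self i
    | _ => simp [fs, fr, muGen]
  · simp [fs, muGen]
  · simp [fs, fr, muGen]

/-- The homomorphism `μ : GVB_n → S_n` with `μ(s_i) = 1` and `μ(ρ_i) = (i, i+1)`. -/
def mu (n : ℕ) : GVB n →* Equiv.Perm (Fin n) := PresentedGroup.toGroup (muGen_relators n)

/-- The group `GH_n`, the kernel of `μ`. -/
abbrev GH (n : ℕ) : Subgroup (GVB n) := (mu n).ker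

/-- `ι` exhibits `GVB_n` as the internal semidirect product of `GH_n` and `S_n`: it is a section of
`μ` with `(i, i+1) ↦ ρ_i`, and `(h, π) ↦ h * ι π` is an isomorphism from the semidirect product in
which `S_n` acts on `GH_n` by conjugation through `ι`. -/
def IsSemidirectVia (n : ℕ) (ι : Equiv.Perm (Fin n) →* GVB n) : Prop :=
  (∀ i : Fin (n - 1), ι (adjSwap i) = rho i) ∧
  (mu n).comp ι = MonoidHom.id _ ∧
  ∃ e : (GH n) ⋊[(MulAut.conjNormal (H := GH n)).comp ι] (Equiv.Perm (Fin n)) ≃* GVB n,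
    ∀ (h : GH n) (π : Equiv.Perm (Fin n)), e ⟨h, π⟩ = (h : GVB n) * ι π

/-- A finitely generated Coxeter group: a group that has a Coxeter system with finitely many simple
reflections. -/
def IsFGCoxeter (W : Type) [Group W] : Prop :=
  ∃ (B : Type) (_ : Finite B) (M : CoxeterMatrix B), Nonempty (CoxeterSystem M W)

/-- A group is linear if it has a faithful finite-dimensional representation over some field. -/
def IsLinear (G : Type) [Group G] : Prop :=
  ∃ (K : Type) (_ : Field K) (d : ℕ) (r : G →* Matrix.GeneralLinearGroup (Fin d) K),
    Function.Injective r

end GaussBraid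

/-! Let W be the Coxeter group with one simple reflection for each two-element set of strands, with
m = 2 for disjoint sets and m = 3 for distinct sets that meet. The symmetric group permutes these
sets, preserving the matrix, hence acts on W. The core of the proof is `equivPairSemidirect`: GVB_n
≅ W ⋊ S_n, where s_i corresponds to the reflection of {i, i+1} and ρ_i to (i, i+1). The map μ
becomes the projection to S_n, so GH_n is identified with W.

The map to W ⋊ S_n is a check of relators. The inverse needs an element of GVB_n for each pair of
strands, permuted by conjugation exactly as S_n permutes pairs (`iota_conj_pairElt`). Given this
equivariance, every Coxeter relation between such elements is conjugate to a defining relation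
between some s_i and s_j.

The section `iota` exists because S_n has the Coxeter presentation of type A. Both this presentation
and the linearity of GVB_n rest on one positivity argument for simply laced Coxeter groups,
`height_pos_of_length_lt`. It is applied to the vectors e_i - e_{i+1} of the permutation
representation of S_n, and to the geometric representation of W. The latter extends to W ⋊ S_n, and
adding the permutation representation of S_n pulled back along μ makes it faithful. -/

namespace GaussBraid

/-! ### Faithful representations of simply laced Coxeter groups. -/

section Coxeter

variable {B W : Type} [Group W] {M : CoxeterMatrix B} (cs : CoxeterSystem M W)
  {V : Type} [AddCommGroup V] [Module ℚ V]

/-- In a simply laced Coxeter group acting linearly with a system of vectors `α` transforming like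
simple roots, `w` sends `α i` to a vector on which the height `f` is positive as soon as
`ℓ (w s_i) > ℓ w`. -/
theorem height_pos_of_length_lt (hM : ∀ i j, i ≠ j → M i j = 2 ∨ M i j = 3)
    (φ : W →* (V ≃ₗ[ℚ] V)) (α : B → V) (f : V →ₗ[ℚ] ℚ) (hf : ∀ i, 0 < f (α i))
    (h₂ : ∀ i j, M i j = 2 → φ (cs.simple j) (α i) = α i)
    (h₃ : ∀ i j, M i j = 3 → φ (cs.simple j) (α i) = α i + α j)
    (w : W) (i : B) (hw : cs.length w < cs.length (w * cs.simple i)) :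
    0 < f (φ w (α i)) := by
  induction hl : cs.length w using Nat.strong_induction_on generalizing w i with
  | _ l ih =>
    subst hl
    by_cases h1 : w = 1
    · simpa [h1] using hf i
    obtain ⟨j, hj⟩ := cs.exists_rightDescent_of_ne_one h1
    have hj' : cs.length (w * cs.simple j) < cs.length w := hj
    have hij : i ≠ j := by rintro rfl; omega
    have hcancel : φ w (α i) = φ (w * cs.simple j) (φ (cs.simple j) (α i)) := by
      rw [← LinearEquiv.mul_apply, ← map_mul, mul_assoc, cs.simple_mul_simple_self, mul_one]
    have hi := cs.length_mul_simple w i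
    have hjj := cs.length_mul_simple w j
    have hpow := cs.simple_mul_simple_pow i j
    rcases hM i j hij with hm | hm
    · rw [hcancel, h₂ i j hm]
      have hcomm : cs.simple i * cs.simple j = cs.simple j * cs.simple i := by
        rw [hm, pow_two] at hpow
        simpa using eq_inv_of_mul_eq_one_left hpow
      -- Here w s_j s_i = w s_i s_j has length at least ℓ(w s_i) - 1 = ℓ(w) > ℓ(w s_j).
      refine ih _ hj' _ _ ?_ rfl
      have := cs.length_mul_simple (w * cs.simple i) j
      rw [mul_assoc, ← hcomm, ← mul_assoc]
      omega
    · have hbraid : cs.simple i * cs.simple j * cs.simple i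
          = cs.simple j * cs.simple i * cs.simple j := by
        rw [hm, pow_succ, pow_two] at hpow
        have : cs.simple i * cs.simple j * cs.simple i *
          (cs.simple j * cs.simple i * cs.simple j) = 1 := by simpa [mul_assoc] using hpow
        simpa [mul_assoc] using eq_inv_of_mul_eq_one_left this
      have hji : φ (cs.simple i) (α j) = α j + α i := h₃ j i (M.symmetric i j ▸ hm)
      have hwj : 0 < f (φ (w * cs.simple j) (α j)) := by
        refine ih _ hj' _ _ ?_ rfl
        simpa using hj'
      rw [hcancel, h₃ i j hm]
      -- If w s_j s_i is longer than w s_j, both summands of (w s_j)(α_i + α_j) have positive height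
      -- by induction.
      by_cases hlt : cs.length (w * cs.simple j) < cs.length (w * cs.simple j * cs.simple i)
      · have := ih _ hj' _ _ hlt rfl
        rw [map_add, map_add]
        positivity
      -- Otherwise u = w s_j s_i has length ℓ(w) - 2, and α_i + α_j = s_i α_j reduces the claim to
      -- u(α_j). By the braid relation u s_j = w s_i s_j s_i, of length at least ℓ(w s_i) - 2 = ℓ(w)
      -- - 1, so induction applies to u.
      · have e : φ (w * cs.simple j) (α i + α j)
            = φ (w * cs.simple j * cs.simple i) (α j) := by
          rw [map_mul φ (w * cs.simple j), LinearEquiv.mul_apply, hji, add_comm]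
        have h4 := cs.length_mul_simple (w * cs.simple j) i
        rw [e]
        refine ih _ (by omega) _ _ ?_ rfl
        have e2 : w * cs.simple j * cs.simple i * cs.simple j
            = w * cs.simple i * cs.simple j * cs.simple i := by
          simp only [mul_assoc] at hbraid ⊢
          rw [hbraid]
        have h5 := cs.length_mul_simple (w * cs.simple i) j
        have h6 := cs.length_mul_simple (w * cs.simple i * cs.simple j) i
        rw [e2]
        omega

/-- A linear action of a simply laced Coxeter group with a system of vectors transforming like
simple roots and having positive height is faithful. -/
theorem injective_of_height (hM : ∀ i j, i ≠ j → M i j = 2 ∨ M i j = 3)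
    (φ : W →* (V ≃ₗ[ℚ] V)) (α : B → V) (f : V →ₗ[ℚ] ℚ) (hf : ∀ i, 0 < f (α i))
    (h₁ : ∀ i, φ (cs.simple i) (α i) = -α i)
    (h₂ : ∀ i j, M i j = 2 → φ (cs.simple j) (α i) = α i)
    (h₃ : ∀ i j, M i j = 3 → φ (cs.simple j) (α i) = α i + α j) :
    Function.Injective φ := by
  rw [injective_iff_map_eq_one]
  intro w hw
  by_contra h1
  obtain ⟨j, hj⟩ := cs.exists_rightDescent_of_ne_one h1
  -- If w acts trivially and j is a right descent of w, then w s_j sends α_j to -α_j, whose height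
  -- should be positive.
  have := height_pos_of_length_lt cs hM φ α f hf h₂ h₃ (w * cs.simple j) j (by simpa using! hj)
  rw [map_mul, hw, one_mul, h₁, map_neg] at this
  linarith [hf j]

/-- The permutation representation on rational functions. -/
def permRep (G X : Type) [Group G] [MulAction G X] : G →* ((X → ℚ) ≃ₗ[ℚ] (X → ℚ)) where
  toFun g := LinearEquiv.funCongrLeft ℚ ℚ (MulAction.toPerm g⁻¹)
  map_one' := by ext; simp
  map_mul' g h := by ext; simp [mul_smul]

theorem permRep_apply {G X : Type} [Group G] [MulAction G X] (g : G) (v : X → ℚ) (x : X) :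
    permRep G X g v x = v (g⁻¹ • x) := rfl

theorem permRep_single {G X : Type} [Group G] [MulAction G X] [DecidableEq X] (g : G) (x : X)
    (c : ℚ) : permRep G X g (Pi.single x c) = Pi.single (g • x) c := by
  ext y
  simp [permRep_apply, Pi.single_apply, inv_smul_eq_iff]

theorem permRep_injective (G X : Type) [Group G] [MulAction G X] [FaithfulSMul G X] :
    Function.Injective (permRep G X) := by
  classical
  rw [injective_iff_map_eq_one]
  intro g hg
  refine FaithfulSMul.eq_of_smul_eq_smul (α := X) fun x => ?_
  have := permRep_single g x 1
  rw [hg] at this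
  have := congrFun this x
  by_contra h
  simp [Pi.single_apply, one_smul] at this h
  exact h this.symm

section Geometric

variable [Fintype B] [DecidableEq B] (M)

/-- The Cartan matrix of a simply laced Coxeter matrix. -/
def cartan (i j : B) : ℚ := if M i j = 1 then 2 else if M i j = 2 then 0 else -1

/-- The simple coroot of index `i`, as a functional on the geometric representation. -/
def coroot (i : B) : (B → ℚ) →ₗ[ℚ] ℚ := ∑ j, cartan M j i • LinearMap.proj j

theorem coroot_single (i j : B) : coroot M i (Pi.single j 1) = cartan M j i := by
  simp [coroot, Pi.single_apply]

theorem coroot_single_self (i : B) : coroot M i (Pi.single i 1) = 2 := by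
  simp [coroot_single, cartan]

/-- The simple reflection of index `i` in the geometric representation. -/
def geomReflection (i : B) : (B → ℚ) ≃ₗ[ℚ] (B → ℚ) := Module.reflection (coroot_single_self M i)

theorem geomReflection_isLiftable (hM : ∀ i j, i ≠ j → M i j = 2 ∨ M i j = 3) :
    M.IsLiftable (geomReflection M) := by
  intro i j
  by_cases hij : i = j
  · subst hij
    rw [M.diagonal, pow_one]
    ext1 v
    exact Module.involutive_reflection _ v
  · rcases hM i j hij with h | h
    · have h' : M j i = 2 := M.symmetric i j ▸ h
      rw [h]
      ext1 v
      simp only [pow_two, LinearEquiv.mul_apply, geomReflection, Module.reflection_apply, map_sub,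
        map_smul, coroot_single, LinearEquiv.coe_one, id]
      simp only [cartan, h, h', M.diagonal]
      norm_num
      module
    · have h' : M j i = 3 := M.symmetric i j ▸ h
      rw [h]
      ext1 v
      simp only [pow_succ, pow_zero, one_mul, LinearEquiv.mul_apply, geomReflection,
        Module.reflection_apply, map_sub,
        map_smul, coroot_single, LinearEquiv.coe_one, id]
      simp only [cartan, h, h', M.diagonal]
      norm_num
      module

variable {M}

/-- The geometric representation of a simply laced Coxeter group. -/
noncomputable def geomRep (hM : ∀ i j, i ≠ j → M i j = 2 ∨ M i j = 3) :
    W →* ((B → ℚ) ≃ₗ[ℚ] (B → ℚ)) :=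
  cs.lift ⟨geomReflection M, geomReflection_isLiftable M hM⟩

theorem geomRep_simple (hM : ∀ i j, i ≠ j → M i j = 2 ∨ M i j = 3) (i : B) :
    geomRep cs hM (cs.simple i) = geomReflection M i := cs.lift_apply_simple _ i

theorem geomRep_injective (hM : ∀ i j, i ≠ j → M i j = 2 ∨ M i j = 3) :
    Function.Injective (geomRep cs hM) := by
  refine injective_of_height cs hM _ (fun i => Pi.single i 1) (∑ j, LinearMap.proj j)
    ?_ ?_ ?_ ?_
  · intro i; simp [Pi.single_apply]
  · intro i
    rw [geomRep_simple]
    exact Module.reflection_apply_self _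
  · intro i j h
    rw [geomRep_simple]
    simp [geomReflection, Module.reflection_apply, coroot_single, cartan, h]
  · intro i j h
    rw [geomRep_simple]
    simp [geomReflection, Module.reflection_apply, coroot_single, cartan, h]

end Geometric

end Coxeter

/-! ### From rational representations to matrix groups. -/

/-- A group acting faithfully on a finite-dimensional vector space over `ℚ` is linear. -/
theorem isLinear_of_injective {G V : Type} [Group G] [AddCommGroup V] [Module ℚ V]
    [Module.Finite ℚ V] (φ : G →* (V ≃ₗ[ℚ] V)) (hφ : Function.Injective φ) : IsLinear G := by
  let e := LinearMap.toMatrixAlgEquiv (Module.finBasis ℚ V)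
  refine ⟨ℚ, inferInstance, Module.finrank ℚ V,
    ((Units.map (e : Module.End ℚ V →* _)).comp
      (LinearMap.GeneralLinearGroup.generalLinearEquiv ℚ V).symm.toMonoidHom).comp φ, ?_⟩
  rw [MonoidHom.coe_comp, MonoidHom.coe_comp]
  refine Function.Injective.comp (Function.Injective.comp ?_ (MulEquiv.injective _)) hφ
  exact Units.map_injective e.injective

/-- The kernel of the action on V × V' is the intersection of the two kernels, so neither factor has
to be faithful by itself. -/
theorem isLinear_of_prod {G V V' : Type} [Group G] [AddCommGroup V] [Module ℚ V]
    [Module.Finite ℚ V] [AddCommGroup V'] [Module ℚ V'] [Module.Finite ℚ V']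
    (φ : G →* (V ≃ₗ[ℚ] V)) (ψ : G →* (V' ≃ₗ[ℚ] V'))
    (h : ∀ g, φ g = 1 → ψ g = 1 → g = 1) : IsLinear G := by
  let χ : G →* ((V × V') ≃ₗ[ℚ] (V × V')) :=
    { toFun := fun g => LinearEquiv.prodCongr (φ g) (ψ g)
      map_one' := by ext <;> simp
      map_mul' := fun a b => by ext <;> simp }
  refine isLinear_of_injective χ ((injective_iff_map_eq_one _).2 fun g hg => h g ?_ ?_)
  · ext1 v
    exact congrArg Prod.fst (LinearEquiv.congr_fun hg (v, 0))
  · ext1 v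
    exact congrArg Prod.snd (LinearEquiv.congr_fun hg (0, v))

/-! ### The defining relations as identities in GVB_n. -/

section Relations

variable {n : ℕ}

theorem GVB.mk_eq_mk {u v : FreeGroup (Gen n)} (h : u * v⁻¹ ∈ gaussRelators n) :
    PresentedGroup.mk (gaussRelators n) u = PresentedGroup.mk (gaussRelators n) v := by
  rw [← mul_inv_eq_one, ← map_inv, ← map_mul]
  exact PresentedGroup.one_of_mem h

theorem mk_fs (i : Fin (n - 1)) : PresentedGroup.mk (gaussRelators n) (fs i) = s i := rfl

theorem mk_fr (i : Fin (n - 1)) : PresentedGroup.mk (gaussRelators n) (fr i) = rho i := rfl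

theorem s_mul_self (i : Fin (n - 1)) : (s i : GVB n) * s i = 1 := by
  have := PresentedGroup.one_of_mem (rels := gaussRelators n) (x := fs i ^ 2)
    (.inl (.inr ⟨i, rfl⟩))
  simpa [mk_fs, pow_two] using this

theorem rho_mul_self (i : Fin (n - 1)) : (rho i : GVB n) * rho i = 1 := by
  have := PresentedGroup.one_of_mem (rels := gaussRelators n) (x := fr i ^ 2)
    (.inl (.inl (.rho_sq i)))
  simpa [mk_fr, pow_two] using this

theorem s_braid {i j : Fin (n - 1)} (h : Next i j) :
    (s i * s j * s i : GVB n) = s j * s i * s j := by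
  simpa [mk_fs] using GVB.mk_eq_mk (.inl (.inl (.sigma_braid i j h)))

theorem s_comm {i j : Fin (n - 1)} (h : Far i j) : (s i * s j : GVB n) = s j * s i := by
  simpa [mk_fs] using GVB.mk_eq_mk (.inl (.inl (.sigma_comm i j h)))

theorem rho_braid {i j : Fin (n - 1)} (h : Next i j) :
    (rho i * rho j * rho i : GVB n) = rho j * rho i * rho j := by
  simpa [mk_fr] using GVB.mk_eq_mk (.inl (.inl (.rho_braid i j h)))

theorem rho_comm {i j : Fin (n - 1)} (h : Far i j) : (rho i * rho j : GVB n) = rho j * rho i := by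
  simpa [mk_fr] using GVB.mk_eq_mk (.inl (.inl (.rho_comm i j h)))

theorem s_rho_comm {i j : Fin (n - 1)} (h : Far i j) : (s i * rho j : GVB n) = rho j * s i := by
  simpa [mk_fr, mk_fs] using GVB.mk_eq_mk (.inl (.inl (.sigma_rho_comm i j h)))

theorem s_rho_comm_self (i : Fin (n - 1)) : (s i * rho i : GVB n) = rho i * s i := by
  simpa [mk_fr, mk_fs] using GVB.mk_eq_mk (.inr ⟨i, rfl⟩)

theorem rho_rho_s {i j : Fin (n - 1)} (h : Next i j) :
    (rho i * rho j * s i : GVB n) = s j * rho i * rho j := by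
  simpa [mk_fr, mk_fs] using GVB.mk_eq_mk (.inl (.inl (.mixed i j h)))

end Relations

/-! ### The Coxeter presentation of the symmetric group and the section of μ. -/

section TypeA

variable {n : ℕ}

theorem A_apply (i j : Fin (n - 1)) : CoxeterMatrix.A (n - 1) i j =
    if i = j then 1 else if (j : ℕ) + 1 = i ∨ (i : ℕ) + 1 = j then 3 else 2 := rfl

/-- Elements satisfying the relations of the symmetric group satisfy the Coxeter relations of
type `A`. -/
theorem isLiftable_A {G : Type} [Group G] (f : Fin (n - 1) → G) (h₁ : ∀ i, f i * f i = 1)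
    (h₂ : ∀ i j, Far i j → f i * f j = f j * f i)
    (h₃ : ∀ i j, Next i j → f i * f j * f i = f j * f i * f j) :
    (CoxeterMatrix.A (n - 1)).IsLiftable f := by
  have h₃' : ∀ i j, Next i j → (f i * f j) ^ 3 = 1 := fun i j h => by
    calc (f i * f j) ^ 3 = (f i * f j * f i) * (f j * f i * f j) := by
          simp only [pow_succ, pow_zero, one_mul, mul_assoc]
      _ = f j * (f i * (f j * f j) * f i) * f j := by rw [h₃ i j h]; simp only [mul_assoc]
      _ = 1 := by simp [h₁]
  intro i j
  rw [A_apply]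
  split_ifs with h h'
  · subst h; simp [h₁]
  · rcases h' with h' | h'
    · have := h₃' j i h'.symm
      rw [← inv_inj, ← inv_pow, mul_inv_rev, inv_one,
        ← eq_inv_of_mul_eq_one_left (h₁ i), ← eq_inv_of_mul_eq_one_left (h₁ j)]
      exact this
    · exact h₃' i j h'.symm
  · have hF : Far i j := by
      have : (i : ℕ) ≠ j := fun e => h (Fin.ext e)
      unfold Far; omega
    calc (f i * f j) ^ 2 = (f i * f j) * (f j * f i) := by rw [pow_two, h₂ i j hF]
      _ = f i * (f j * f j) * f i := by simp only [mul_assoc]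
      _ = 1 := by simp [h₁]

/-- The homomorphism from the Coxeter group of type `A` to the symmetric group. -/
noncomputable def toPerm (n : ℕ) : (CoxeterMatrix.A (n - 1)).Group →* Equiv.Perm (Fin n) :=
  (CoxeterMatrix.A (n - 1)).toCoxeterSystem.lift
    ⟨adjSwap, isLiftable_A _ adjSwap_mul_self (fun _ _ => adjSwap_comm) (fun _ _ => adjSwap_braid)⟩

theorem toPerm_simple (i : Fin (n - 1)) :
    toPerm n ((CoxeterMatrix.A (n - 1)).toCoxeterSystem.simple i) = adjSwap i :=
  CoxeterSystem.lift_apply_simple _ _ i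

/-- In the permutation representation the vectors e_i - e_{i+1} transform like simple roots of type
A, so the positivity argument shows that the Coxeter relations suffice to present S_n. -/
theorem toPerm_injective (n : ℕ) : Function.Injective (toPerm n) := by
  have key : Function.Injective ((permRep (Equiv.Perm (Fin n)) (Fin n)).comp (toPerm n)) := by
    refine injective_of_height (CoxeterMatrix.A (n - 1)).toCoxeterSystem ?_ _
      (fun i => Pi.single (⟨i, by omega⟩ : Fin n) 1 - Pi.single (⟨i + 1, by omega⟩ : Fin n) 1)
      -- The weights -j give every e_i - e_{i+1} height -i + (i + 1) = 1.
      (∑ j : Fin n, (-(j : ℚ)) • LinearMap.proj j) ?_ ?_ ?_ ?_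
    · intro i j h
      rw [A_apply, if_neg h]
      split_ifs <;> simp
    · intro i
      simp [Pi.single_apply, mul_sub]
    · intro i
      rw [MonoidHom.comp_apply, toPerm_simple]
      simp [permRep_single, adjSwap]
    · intro i j h
      rw [MonoidHom.comp_apply, toPerm_simple, map_sub, permRep_single, permRep_single]
      rw [A_apply] at h
      split_ifs at h with h1 h2
      · omega
      · omega
      have h1' : (i : ℕ) ≠ j := fun e => h1 (Fin.ext e)
      push Not at h2
      simp only [Equiv.Perm.smul_def, adjSwap]
      rw [Equiv.swap_apply_of_ne_of_ne, Equiv.swap_apply_of_ne_of_ne] <;>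
        simp [Fin.ext_iff] <;> omega
    · intro i j h
      rw [MonoidHom.comp_apply, toPerm_simple, map_sub, permRep_single, permRep_single]
      rw [A_apply] at h
      split_ifs at h with h1 h2
      · omega
      on_goal 2 => omega
      simp only [Equiv.Perm.smul_def, adjSwap]
      rcases h2 with h2 | h2
      · have e : (⟨i, by omega⟩ : Fin n) = ⟨j + 1, by omega⟩ := Fin.ext h2.symm
        rw [e, Equiv.swap_apply_right, Equiv.swap_apply_of_ne_of_ne]
        · abel
        all_goals simp [Fin.ext_iff]; try omega
      · have e : (⟨i + 1, by omega⟩ : Fin n) = ⟨j, by omega⟩ := Fin.ext h2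
        rw [e, Equiv.swap_apply_left, Equiv.swap_apply_of_ne_of_ne]
        · abel
        all_goals simp [Fin.ext_iff]; try omega
  rw [MonoidHom.coe_comp] at key
  exact Function.Injective.of_comp key

theorem mclosure_range_adjSwap (n : ℕ) :
    Submonoid.closure (Set.range (adjSwap : Fin (n - 1) → Equiv.Perm (Fin n))) = ⊤ := by
  cases n with
  | zero => exact Subsingleton.elim _ _
  | succ n => exact Equiv.Perm.mclosure_swap_castSucc_succ n

theorem toPerm_surjective (n : ℕ) : Function.Surjective (toPerm n) := by
  rw [← MonoidHom.mrange_eq_top, eq_top_iff, ← mclosure_range_adjSwap, Submonoid.closure_le]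
  rintro _ ⟨i, rfl⟩
  exact ⟨_, toPerm_simple i⟩

/-- The section of `μ`. -/
noncomputable def iota (n : ℕ) : Equiv.Perm (Fin n) →* GVB n :=
  ((CoxeterMatrix.A (n - 1)).toCoxeterSystem.lift
    ⟨rho, isLiftable_A _ rho_mul_self (fun _ _ => rho_comm) (fun _ _ => rho_braid)⟩).comp
  (MulEquiv.ofBijective (toPerm n) ⟨toPerm_injective n, toPerm_surjective n⟩).symm.toMonoidHom

theorem iota_adjSwap (i : Fin (n - 1)) : iota n (adjSwap i) = rho i := by
  have : (MulEquiv.ofBijective (toPerm n) ⟨toPerm_injective n, toPerm_surjective n⟩).symm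
      (adjSwap i) = (CoxeterMatrix.A (n - 1)).toCoxeterSystem.simple i := by
    rw [MulEquiv.symm_apply_eq]
    exact (toPerm_simple i).symm
  simp only [iota, MonoidHom.comp_apply, MulEquiv.toMonoidHom_eq_coe, MonoidHom.coe_coe]
  rw [this, CoxeterSystem.lift_apply_simple]

theorem mu_s (i : Fin (n - 1)) : mu n (s i) = 1 := PresentedGroup.toGroup.of _

theorem mu_rho (i : Fin (n - 1)) : mu n (rho i) = adjSwap i := PresentedGroup.toGroup.of _

theorem mu_comp_iota : (mu n).comp (iota n) = MonoidHom.id _ := by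
  refine MonoidHom.eq_of_eqOn_denseM (mclosure_range_adjSwap n) ?_
  rintro _ ⟨i, rfl⟩
  simp [iota_adjSwap, mu_rho]

theorem isSemidirectVia_iota (n : ℕ) : IsSemidirectVia n (iota n) := by
  refine ⟨iota_adjSwap, mu_comp_iota, ?_⟩
  have hι (π) : mu n (iota n π) = π := DFunLike.congr_fun mu_comp_iota π
  let F : (GH n) ⋊[(MulAut.conjNormal (H := GH n)).comp (iota n)] (Equiv.Perm (Fin n)) →* GVB n :=
    SemidirectProduct.lift (GH n).subtype (iota n) fun g => by
      ext h
      simp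
  have hF (h : GH n) (π : Equiv.Perm (Fin n)) : F ⟨h, π⟩ = (h : GVB n) * iota n π := rfl
  refine ⟨MulEquiv.ofBijective F ⟨?_, fun g => ?_⟩, hF⟩
  · rw [injective_iff_map_eq_one]
    rintro ⟨h, π⟩ e
    rw [hF] at e
    have hh : mu n h = 1 := h.2
    have hπ : π = 1 := by simpa [hh, hι] using congrArg (mu n) e
    subst hπ
    ext <;> simp_all
  · refine ⟨⟨⟨g * (iota n (mu n g))⁻¹, ?_⟩, mu n g⟩, ?_⟩
    · simp [MonoidHom.mem_ker, hι]
    · simp [hF]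

end TypeA

/-! ### Conjugates of the s_i indexed by pairs of strands. -/

section Pairs

open scoped Pointwise

variable {n : ℕ}

/-- `ρ_k`, extended by `1` outside the range of indices. -/
def natRho (n k : ℕ) : GVB n := if h : k < n - 1 then rho ⟨k, h⟩ else 1

/-- `s_k`, extended by `1` outside the range of indices. -/
def natS (n k : ℕ) : GVB n := if h : k < n - 1 then s ⟨k, h⟩ else 1

/-- Conjugation by the involution `ρ_k`. -/
def rhoConj (k : ℕ) (g : GVB n) : GVB n := natRho n k * g * natRho n k

theorem natRho_mul_self (k : ℕ) : natRho n k * natRho n k = 1 := by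
  unfold natRho
  split_ifs
  exacts [rho_mul_self _, one_mul _]

theorem rhoConj_rhoConj (k : ℕ) (g : GVB n) : rhoConj k (rhoConj k g) = g := by
  simp only [rhoConj, mul_assoc, natRho_mul_self, mul_one]
  rw [← mul_assoc, natRho_mul_self, one_mul]

theorem natRho_comm {k l : ℕ} (h : k + 2 ≤ l) :
    natRho n k * natRho n l = natRho n l * natRho n k := by
  unfold natRho
  split_ifs
  · exact rho_comm (.inl h)
  all_goals simp

theorem rhoConj_comm {k l : ℕ} (h : k + 2 ≤ l) (g : GVB n) :
    rhoConj k (rhoConj l g) = rhoConj l (rhoConj k g) := by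
  have e := natRho_comm (n := n) h
  calc _ = (natRho n k * natRho n l) * g * (natRho n l * natRho n k) := by
        simp only [rhoConj, mul_assoc]
    _ = (natRho n l * natRho n k) * g * (natRho n k * natRho n l) := by rw [e]
    _ = _ := by simp only [rhoConj, mul_assoc]

theorem rhoConj_braid {k : ℕ} (h : k + 1 < n - 1) (g : GVB n) :
    rhoConj k (rhoConj (k + 1) (rhoConj k g))
      = rhoConj (k + 1) (rhoConj k (rhoConj (k + 1) g)) := by
  have e : natRho n k * natRho n (k + 1) * natRho n k
      = natRho n (k + 1) * natRho n k * natRho n (k + 1) := by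
    simp only [natRho, h, (by omega : k < n - 1), dif_pos]
    exact rho_braid rfl
  calc _ = (natRho n k * natRho n (k + 1) * natRho n k) * g *
        (natRho n k * natRho n (k + 1) * natRho n k) := by simp only [rhoConj, mul_assoc]
    _ = (natRho n (k + 1) * natRho n k * natRho n (k + 1)) * g *
        (natRho n (k + 1) * natRho n k * natRho n (k + 1)) := by rw [e]
    _ = _ := by simp only [rhoConj, mul_assoc]

theorem rhoConj_eq_self {k : ℕ} {g : GVB n} (h : g * natRho n k = natRho n k * g) :
    rhoConj k g = g := by
  rw [rhoConj, ← h, mul_assoc, natRho_mul_self, mul_one]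

theorem rhoConj_natS_of_far {k a : ℕ} (h : k + 2 ≤ a ∨ a + 2 ≤ k) :
    rhoConj k (natS n a) = natS n a := by
  refine rhoConj_eq_self ?_
  unfold natRho natS
  split_ifs
  · exact s_rho_comm h.symm
  all_goals simp

theorem rhoConj_natS_self (a : ℕ) : rhoConj a (natS n a) = natS n a := by
  refine rhoConj_eq_self ?_
  unfold natRho natS
  split_ifs
  · exact s_rho_comm_self _
  all_goals simp

/-- This is the mixed relation rearranged: the pair {a, a+2} gets the same element whether {a+1,
a+2} has its lower strand moved down or {a, a+1} its upper strand moved up. -/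
theorem rhoConj_natS_succ {a : ℕ} (h : a + 1 < n - 1) :
    rhoConj a (natS n (a + 1)) = rhoConj (a + 1) (natS n a) := by
  have e : natRho n a * natRho n (a + 1) * natS n a
      = natS n (a + 1) * natRho n a * natRho n (a + 1) := by
    simp only [natRho, natS, h, (by omega : a < n - 1), dif_pos]
    exact rho_rho_s rfl
  calc rhoConj a (natS n (a + 1))
      = natRho n a * (natS n (a + 1) * natRho n a * natRho n (a + 1)) * natRho n (a + 1) := by
        simp only [rhoConj, mul_assoc, natRho_mul_self, mul_one]
    _ = (natRho n a * natRho n a) * (natRho n (a + 1) * natS n a * natRho n (a + 1)) := by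
        rw [← e]; simp only [mul_assoc]
    _ = _ := by rw [natRho_mul_self, one_mul, rhoConj]

/-- The conjugate of `s_a` attached to the pair of strands `a`, `a + d + 1`. -/
def edge (n a : ℕ) : ℕ → GVB n
  | 0 => natS n a
  | d + 1 => rhoConj (a + d + 1) (edge n a d)

theorem rhoConj_edge_of_far {k a d : ℕ} (h : k + 2 ≤ a ∨ a + d + 2 ≤ k) :
    rhoConj k (edge n a d) = edge n a d := by
  induction d with
  | zero => exact rhoConj_natS_of_far h
  | succ d ih =>
    rw [edge]
    rcases h with h | h
    · rw [rhoConj_comm (by omega), ih (by omega)]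
    · rw [← rhoConj_comm (by omega), ih (by omega)]

/-- `edge` is built by moving the upper strand. Moving the lower strand commutes with all those
moves except the first, where `rhoConj_natS_succ` takes over. -/
theorem rhoConj_edge_pred {a d : ℕ} (h : a + 1 < n - 1) :
    rhoConj a (edge n (a + 1) d) = edge n a (d + 1) := by
  induction d with
  | zero => exact rhoConj_natS_succ h
  | succ d ih =>
    rw [edge, rhoConj_comm (by omega), ih, edge.eq_def n a (d + 1 + 1)]
    congr 1
    omega

/-- The strands k and k + 1 lie strictly between the endpoints a and a + d + 1. Unless k is the last
such index, ρ_k commutes past the outermost conjugation. -/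
theorem rhoConj_edge_of_between {k a d : ℕ} (h₁ : a < k) (h₂ : k < a + d) (h : a + d < n - 1) :
    rhoConj k (edge n a d) = edge n a d := by
  induction d with
  | zero => omega
  | succ d ih =>
    obtain rfl | hk := eq_or_ne k (a + d)
    -- For the last index the element is x = `edge n a e` conjugated by ρ_k, then by ρ_{k+1}. The
    -- braid relation replaces the outer ρ_k by an innermost ρ_{k+1}, which fixes x because its
    -- strands lie above those of x.
    · obtain ⟨e, rfl⟩ : ∃ e, d = e + 1 := ⟨d - 1, by omega⟩
      rw [edge, edge]
      have := rhoConj_braid (n := n) (k := a + e + 1) (by omega) (edge n a e)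
      rw [← add_assoc, this, rhoConj_edge_of_far (k := a + e + 1 + 1) (.inr (by omega))]
    · rw [edge, rhoConj_comm (by omega), ih (by omega) (by omega)]

/-- The two-element subsets of the set of strands. -/
abbrev Pair (n : ℕ) : Type := Set.powersetCard (Fin n) 2

theorem Pair.nonempty (p : Pair n) : p.1.Nonempty :=
  Finset.card_pos.1 (by rw [p.2]; norm_num)

theorem Pair.exists_eq (p : Pair n) : ∃ a b : Fin n, a < b ∧ p.1 = {a, b} := by
  obtain ⟨a, b, hab, h⟩ := Finset.card_eq_two.1 p.2
  rcases lt_or_gt_of_ne hab with h' | h'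
  · exact ⟨a, b, h', h⟩
  · exact ⟨b, a, h', by rw [h, Finset.pair_comm]⟩

/-- The pair `{i, i + 1}`. -/
def adjPair (i : Fin (n - 1)) : Pair n :=
  ⟨{(⟨i, by omega⟩ : Fin n), (⟨i + 1, by omega⟩ : Fin n)}, Finset.card_pair (by simp [Fin.ext_iff])⟩

theorem Pair.smul_val_eq {p : Pair n} {a b : Fin n} (h : p.1 = {a, b}) (g : Equiv.Perm (Fin n)) :
    (g • p).1 = {g a, g b} := by
  rw [Set.powersetCard.coe_smul, h]
  simp [Finset.smul_finset_insert]

/-- The element of `GVB_n` attached to a pair of strands. -/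
def pairElt (p : Pair n) : GVB n :=
  edge n (p.1.min' p.nonempty) (p.1.max' p.nonempty - p.1.min' p.nonempty - 1)

theorem pairElt_eq {p : Pair n} {a b : Fin n} (hab : a < b) (h : p.1 = {a, b}) :
    pairElt p = edge n a (b - a - 1) := by
  have h₁ : p.1.min' p.nonempty = a := by
    simp only [h, Finset.min'_pair, min_eq_left hab.le]
  have h₂ : p.1.max' p.nonempty = b := by
    simp only [h, Finset.max'_pair, max_eq_right hab.le]
  rw [pairElt, h₁, h₂]

theorem pairElt_adjPair (i : Fin (n - 1)) : pairElt (adjPair i) = s i := by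
  rw [pairElt_eq (a := ⟨i, by omega⟩) (b := ⟨i + 1, by omega⟩) (by simp) rfl]
  simp [edge, natS]

/-- Equivariance for the generators of S_n. The cases are the positions of k, k + 1 relative to the
endpoints of the pair: disjoint from them on the outside, meeting one endpoint from outside,
strictly inside, equal to the pair, or meeting one endpoint from inside. -/
theorem rhoConj_pairElt (k : Fin (n - 1)) (p : Pair n) :
    rhoConj (k : ℕ) (pairElt p) = pairElt (adjSwap k • p) := by
  obtain ⟨a, b, hab, hp⟩ := p.exists_eq
  have hs := Pair.smul_val_eq hp (adjSwap k)
  rw [pairElt_eq hab hp]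
  obtain ⟨k, hk⟩ := k
  obtain ⟨a, ha⟩ := a
  obtain ⟨b, hb⟩ := b
  obtain ⟨d, rfl⟩ : ∃ d, b = a + d + 1 := ⟨b - a - 1, by simp at hab; omega⟩
  have hd : a + d + 1 - a - 1 = d := by omega
  simp only [hd]
  have sw (x : Fin n) : (adjSwap ⟨k, hk⟩ x : ℕ) =
      if (x : ℕ) = k then k + 1 else if (x : ℕ) = k + 1 then k else x := by
    simp only [adjSwap, Equiv.swap_apply_def, Fin.ext_iff]
    split_ifs <;> rfl
  -- It suffices to name the image pair in increasing order. The second alternative occurs when the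
  -- transposition exchanges the two endpoints.
  have key (a' b' : ℕ) (ha' : a' < n) (hb' : b' < n) (h : a' < b')
      (e : ((if a = k then k + 1 else if a = k + 1 then k else a) = a' ∧
          (if a + d + 1 = k then k + 1 else if a + d + 1 = k + 1 then k else a + d + 1) = b') ∨
        ((if a = k then k + 1 else if a = k + 1 then k else a) = b' ∧
          (if a + d + 1 = k then k + 1 else if a + d + 1 = k + 1 then k else a + d + 1) = a')) :
      pairElt (adjSwap ⟨k, hk⟩ • p) = edge n a' (b' - a' - 1) := by
    refine pairElt_eq (a := ⟨a', ha'⟩) (b := ⟨b', hb'⟩) h (hs.trans ?_)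
    rcases e with e | e
    · rw [Fin.ext ((sw ⟨a, ha⟩).trans e.1 : _ = ((⟨a', ha'⟩ : Fin n) : ℕ)),
        Fin.ext ((sw ⟨a + d + 1, hb⟩).trans e.2 : _ = ((⟨b', hb'⟩ : Fin n) : ℕ))]
    · rw [Fin.ext ((sw ⟨a, ha⟩).trans e.1 : _ = ((⟨b', hb'⟩ : Fin n) : ℕ)),
        Fin.ext ((sw ⟨a + d + 1, hb⟩).trans e.2 : _ = ((⟨a', ha'⟩ : Fin n) : ℕ)),
        Finset.pair_comm]
  by_cases h1 : k + 2 ≤ a ∨ a + d + 2 ≤ k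
  · rw [rhoConj_edge_of_far h1, key a (a + d + 1) ha hb (by omega), hd]
    split_ifs <;> omega
  by_cases h2 : a = k + 1
  · subst h2
    rw [rhoConj_edge_pred (by omega), key k (k + 1 + d + 1) (by omega) hb (by omega)]
    · congr 1; omega
    · split_ifs <;> omega
  by_cases h3 : k = a + d + 1
  · subst h3
    rw [key a (a + d + 1 + 1) ha (by omega) (by omega),
      (by omega : a + d + 1 + 1 - a - 1 = d + 1), edge]
    split_ifs <;> omega
  by_cases h4 : a < k ∧ k < a + d
  · rw [rhoConj_edge_of_between h4.1 h4.2 (by omega), key a (a + d + 1) ha hb (by omega), hd]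
    split_ifs <;> omega
  rcases d with _ | d
  · obtain rfl : k = a := by omega
    rw [edge, rhoConj_natS_self, key k (k + 0 + 1) ha hb (by omega), hd, edge]
    split_ifs <;> omega
  -- The two remaining moves bring an endpoint inwards. They undo the outward moves treated above,
  -- since conjugation by ρ_k is an involution.
  obtain rfl | h5 := eq_or_ne k a
  · rw [← rhoConj_edge_pred (by omega), rhoConj_rhoConj,
      key (k + 1) (k + (d + 1) + 1) (by omega) hb (by omega)]
    · congr 1; omega
    · split_ifs <;> omega
  · obtain rfl : k = a + d + 1 := by omega
    rw [edge, rhoConj_rhoConj, key a (a + d + 1) ha (by omega) (by omega)]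
    · congr 1; omega
    · split_ifs <;> omega

theorem iota_conj_pairElt (π : Equiv.Perm (Fin n)) (p : Pair n) :
    iota n π * pairElt p * (iota n π)⁻¹ = pairElt (π • p) := by
  have hπ : π ∈ Submonoid.closure (Set.range (adjSwap : Fin (n - 1) → _)) := by
    rw [mclosure_range_adjSwap]; trivial
  induction hπ using Submonoid.closure_induction generalizing p with
  | mem x hx =>
    obtain ⟨k, rfl⟩ := hx
    have h : natRho n k = rho k := by simp [natRho]
    rw [iota_adjSwap, ← rhoConj_pairElt, rhoConj, h, ← eq_inv_of_mul_eq_one_left (rho_mul_self k)]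
  | one => simp
  | mul x y _ _ hx hy =>
    rw [mul_smul, ← hx, ← hy, map_mul, mul_inv_rev]
    simp only [mul_assoc]

end Pairs

/-! ### Transitivity of the symmetric group on configurations of two pairs. -/

open scoped Pointwise

variable {n : ℕ}

theorem mul_pow_two_eq_one_iff {G : Type} [Group G] {a b : G} (ha : a * a = 1) (hb : b * b = 1) :
    (a * b) ^ 2 = 1 ↔ a * b = b * a := by
  rw [pow_two, mul_eq_one_iff_eq_inv, mul_inv_rev, ← eq_inv_of_mul_eq_one_left ha,
    ← eq_inv_of_mul_eq_one_left hb]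

theorem mul_pow_three_eq_one_iff {G : Type} [Group G] {a b : G} (ha : a * a = 1)
    (hb : b * b = 1) : (a * b) ^ 3 = 1 ↔ a * b * a = b * a * b := by
  have : (a * b) ^ 3 = (a * b * a) * (b * a * b) := by
    simp only [pow_succ, pow_zero, one_mul, mul_assoc]
  rw [this, mul_eq_one_iff_eq_inv, mul_inv_rev, mul_inv_rev, ← eq_inv_of_mul_eq_one_left ha,
    ← eq_inv_of_mul_eq_one_left hb, mul_assoc b]

theorem smul_adjPair_eq {π : Equiv.Perm (Fin n)} {i : Fin (n - 1)} {p : Pair n} {a b : Fin n}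
    (hp : p.1 = {a, b}) (ha : π ⟨i, by omega⟩ = a) (hb : π ⟨i + 1, by omega⟩ = b) :
    π • adjPair i = p := by
  refine Subtype.ext ?_
  rw [Pair.smul_val_eq rfl, hp, ha, hb]

/-- S_n can send the strands 0, 1, 2, 3 to any four distinct strands, so i = 0 and j = 2 always
work. -/
theorem exists_smul_adjPair_of_disjoint {p q : Pair n} (h : Disjoint p.1 q.1) :
    ∃ (π : Equiv.Perm (Fin n)) (i j : Fin (n - 1)), Far i j ∧ π • adjPair i = p ∧
      π • adjPair j = q := by
  obtain ⟨a, b, hab, hp⟩ := p.exists_eq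
  obtain ⟨c, d, hcd, hq⟩ := q.exists_eq
  have hf : Function.Injective ![a, b, c, d] := by
    rw [hp, hq] at h
    simp only [Finset.disjoint_insert_left, Finset.disjoint_singleton_left, Finset.mem_insert,
      Finset.mem_singleton] at h
    have := hab.ne
    have := hcd.ne
    intro x y hxy
    fin_cases x <;> fin_cases y <;> simp at hxy ⊢ <;> grind
  have hn : 4 ≤ n := by simpa using Fintype.card_le_of_injective _ hf
  obtain ⟨π, hπ⟩ := Equiv.Perm.exists_extending_pair (Fin.castLE hn) ![a, b, c, d]
    (Fin.castLE_injective hn) hf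
  exact ⟨π, ⟨0, by omega⟩, ⟨2, by omega⟩, .inl le_rfl, smul_adjPair_eq hp (hπ 0) (hπ 1),
    smul_adjPair_eq hq (hπ 2) (hπ 3)⟩

/-- The common strand is taken as the image of 1, so that the two pairs come from {0, 1} and {1, 2}.
-/
theorem exists_smul_adjPair_of_not_disjoint {p q : Pair n} (hpq : p ≠ q)
    (h : ¬ Disjoint p.1 q.1) :
    ∃ (π : Equiv.Perm (Fin n)) (i j : Fin (n - 1)), Next i j ∧ π • adjPair i = p ∧
      π • adjPair j = q := by
  obtain ⟨b, hbp, hbq⟩ := Finset.not_disjoint_iff.1 h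
  obtain ⟨a, hab, hp⟩ : ∃ a, a ≠ b ∧ p.1 = {a, b} := by
    obtain ⟨x, y, hxy, hp⟩ := p.exists_eq
    rw [hp, Finset.mem_insert, Finset.mem_singleton] at hbp
    rcases hbp with rfl | rfl
    · exact ⟨y, hxy.ne', hp.trans (Finset.pair_comm _ _)⟩
    · exact ⟨x, hxy.ne, hp⟩
  obtain ⟨c, hcb, hq⟩ : ∃ c, c ≠ b ∧ q.1 = {b, c} := by
    obtain ⟨x, y, hxy, hq⟩ := q.exists_eq
    rw [hq, Finset.mem_insert, Finset.mem_singleton] at hbq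
    rcases hbq with rfl | rfl
    · exact ⟨y, hxy.ne', hq⟩
    · exact ⟨x, hxy.ne, hq.trans (Finset.pair_comm _ _)⟩
  have hac : a ≠ c := by
    rintro rfl
    exact hpq (Subtype.ext (hp.trans ((Finset.pair_comm _ _).trans hq.symm)))
  have hf : Function.Injective ![a, b, c] := by
    intro x y hxy
    fin_cases x <;> fin_cases y <;> simp at hxy ⊢ <;> grind
  have hn : 3 ≤ n := by simpa using Fintype.card_le_of_injective _ hf
  obtain ⟨π, hπ⟩ := Equiv.Perm.exists_extending_pair (Fin.castLE hn) ![a, b, c]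
    (Fin.castLE_injective hn) hf
  exact ⟨π, ⟨0, by omega⟩, ⟨1, by omega⟩, rfl, smul_adjPair_eq hp (hπ 0) (hπ 1),
    smul_adjPair_eq hq (hπ 1) (hπ 2)⟩

theorem exists_smul_adjPair (p : Pair n) :
    ∃ (π : Equiv.Perm (Fin n)) (i : Fin (n - 1)), π • adjPair i = p := by
  obtain ⟨a, b, hab, hp⟩ := p.exists_eq
  have hf : Function.Injective ![a, b] := by
    have := hab.ne
    intro x y hxy
    fin_cases x <;> fin_cases y <;> simp at hxy ⊢ <;> grind
  have hn : 2 ≤ n := by simpa using Fintype.card_le_of_injective _ hf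
  obtain ⟨π, hπ⟩ := Equiv.Perm.exists_extending_pair (Fin.castLE hn) ![a, b]
    (Fin.castLE_injective hn) hf
  exact ⟨π, ⟨0, by omega⟩, smul_adjPair_eq hp (hπ 0) (hπ 1)⟩

/-! ### The Coxeter group on pairs and its map to GVB_n. -/

/-- The Coxeter matrix of `GH_n`: simple reflections are indexed by pairs of strands, those of
disjoint pairs commute and those of distinct meeting pairs satisfy the braid relation. -/
def pairMatrix (n : ℕ) : CoxeterMatrix (Pair n) where
  M := Matrix.of fun p q => if p = q then 1 else if Disjoint p.1 q.1 then 2 else 3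
  isSymm := by
    ext p q
    simp only [Matrix.transpose_apply, Matrix.of_apply, eq_comm (a := q), disjoint_comm (a := q.1)]
  diagonal := by simp
  off_diagonal p q h := by
    simp only [Matrix.of_apply, if_neg h]
    split_ifs <;> simp

theorem pairMatrix_apply (p q : Pair n) :
    pairMatrix n p q = if p = q then 1 else if Disjoint p.1 q.1 then 2 else 3 := rfl

theorem pairMatrix_eq_two_or_three (p q : Pair n) (h : p ≠ q) :
    pairMatrix n p q = 2 ∨ pairMatrix n p q = 3 := by
  rw [pairMatrix_apply, if_neg h]
  split_ifs <;> simp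

/-- This invariance lets permutations of the simple reflections extend to automorphisms of the
Coxeter group. -/
theorem pairMatrix_smul (π : Equiv.Perm (Fin n)) (p q : Pair n) :
    pairMatrix n (π • p) (π • q) = pairMatrix n p q := by
  have h : Disjoint (π • p.1) (π • q.1) ↔ Disjoint p.1 q.1 := by
    rw [← Finset.disjoint_coe, ← Finset.disjoint_coe, Finset.coe_smul_finset,
      Finset.coe_smul_finset, Set.disjoint_smul_set]
  simp only [pairMatrix_apply, smul_left_cancel_iff, Set.powersetCard.coe_smul, h]

/-- The Coxeter system with matrix `pairMatrix n`. -/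
def pairSystem (n : ℕ) : CoxeterSystem (pairMatrix n) (pairMatrix n).Group :=
  (pairMatrix n).toCoxeterSystem

/-- The endomorphism of the Coxeter group induced by a permutation of the strands. -/
noncomputable def pairEnd (π : Equiv.Perm (Fin n)) :
    (pairMatrix n).Group →* (pairMatrix n).Group :=
  (pairSystem n).lift ⟨fun p => (pairSystem n).simple (π • p), fun p q => by
    rw [← pairMatrix_smul π, CoxeterSystem.simple_mul_simple_pow]⟩

theorem pairEnd_simple (π : Equiv.Perm (Fin n)) (p : Pair n) :
    pairEnd π ((pairSystem n).simple p) = (pairSystem n).simple (π • p) :=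
  CoxeterSystem.lift_apply_simple _ _ p

theorem pairEnd_comp (π σ : Equiv.Perm (Fin n)) :
    (pairEnd π).comp (pairEnd σ) = pairEnd (π * σ) :=
  (pairSystem n).ext_simple fun p => by simp [pairEnd_simple, mul_smul]

theorem pairEnd_one : pairEnd (1 : Equiv.Perm (Fin n)) = MonoidHom.id _ :=
  (pairSystem n).ext_simple fun p => by simp [pairEnd_simple]

/-- The action of the symmetric group on the Coxeter group. -/
noncomputable def pairAut (n : ℕ) : Equiv.Perm (Fin n) →* MulAut (pairMatrix n).Group where
  toFun π := (pairEnd π).toMulEquiv (pairEnd π⁻¹)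
    (by rw [pairEnd_comp, inv_mul_cancel, pairEnd_one])
    (by rw [pairEnd_comp, mul_inv_cancel, pairEnd_one])
  map_one' := by
    ext w
    exact DFunLike.congr_fun pairEnd_one w
  map_mul' π σ := by
    ext w
    exact (DFunLike.congr_fun (pairEnd_comp π σ) w).symm

theorem pairAut_simple (π : Equiv.Perm (Fin n)) (p : Pair n) :
    pairAut n π ((pairSystem n).simple p) = (pairSystem n).simple (π • p) := pairEnd_simple π p

/-- The semidirect product that is isomorphic to `GVB_n`. -/
abbrev PairSemidirect (n : ℕ) : Type :=
  (pairMatrix n).Group ⋊[pairAut n] Equiv.Perm (Fin n)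

theorem pairElt_smul_mul_pow (π : Equiv.Perm (Fin n)) (i j : Fin (n - 1)) (m : ℕ) :
    (pairElt (π • adjPair i) * pairElt (π • adjPair j)) ^ m
      = iota n π * (s i * s j) ^ m * (iota n π)⁻¹ := by
  rw [← iota_conj_pairElt, ← iota_conj_pairElt, pairElt_adjPair, pairElt_adjPair, ← conj_pow]
  simp only [mul_assoc, inv_mul_cancel_left]

/-- By transitivity and equivariance each relation is a conjugate, under `iota`, of an involution,
commutation or braid relation among the s_i. -/
theorem isLiftable_pairElt (n : ℕ) : (pairMatrix n).IsLiftable (pairElt (n := n)) := by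
  intro p q
  rw [pairMatrix_apply]
  split_ifs with h h'
  · subst h
    obtain ⟨π, i, rfl⟩ := exists_smul_adjPair p
    rw [pairElt_smul_mul_pow, s_mul_self]
    simp
  · obtain ⟨π, i, j, hij, rfl, rfl⟩ := exists_smul_adjPair_of_disjoint h'
    rw [pairElt_smul_mul_pow, (mul_pow_two_eq_one_iff (s_mul_self i) (s_mul_self j)).2 (s_comm hij)]
    simp
  · obtain ⟨π, i, j, hij, rfl, rfl⟩ := exists_smul_adjPair_of_not_disjoint h h'
    rw [pairElt_smul_mul_pow,
      (mul_pow_three_eq_one_iff (s_mul_self i) (s_mul_self j)).2 (s_braid hij)]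
    simp

/-- The homomorphism from the Coxeter group to `GVB_n`. -/
noncomputable def pairHom (n : ℕ) : (pairMatrix n).Group →* GVB n :=
  (pairSystem n).lift ⟨pairElt, isLiftable_pairElt n⟩

theorem pairHom_simple (p : Pair n) : pairHom n ((pairSystem n).simple p) = pairElt p :=
  CoxeterSystem.lift_apply_simple _ _ p

/-- The homomorphism from the semidirect product to `GVB_n`. -/
noncomputable def ofPairSemidirect (n : ℕ) : PairSemidirect n →* GVB n :=
  SemidirectProduct.lift (pairHom n) (iota n) fun π =>
    (pairSystem n).ext_simple fun p => by
      simp only [MonoidHom.comp_apply, MulEquiv.coe_toMonoidHom, MulAut.conj_apply,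
        pairAut_simple, pairHom_simple, iota_conj_pairElt]

/-! ### The isomorphism of GVB_n with the semidirect product. -/

theorem adjSwap_smul_adjPair (i : Fin (n - 1)) : adjSwap i • adjPair i = adjPair i := by
  refine Subtype.ext ?_
  rw [Pair.smul_val_eq rfl, adjSwap, Equiv.swap_apply_left, Equiv.swap_apply_right,
    Finset.pair_comm]
  rfl

theorem adjSwap_smul_adjPair_of_far {i j : Fin (n - 1)} (h : Far i j) :
    adjSwap j • adjPair i = adjPair i := by
  refine Subtype.ext ?_
  unfold Far at h
  rw [Pair.smul_val_eq rfl, adjSwap, Equiv.swap_apply_of_ne_of_ne, Equiv.swap_apply_of_ne_of_ne]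
  · rfl
  all_goals simp only [ne_eq, Fin.mk.injEq]; omega

theorem adjSwap_smul_adjSwap_smul_adjPair {i j : Fin (n - 1)} (h : Next i j) :
    (adjSwap i * adjSwap j) • adjPair i = adjPair j := by
  refine Subtype.ext ?_
  obtain ⟨i, hi⟩ := i
  obtain ⟨j, hj⟩ := j
  obtain rfl : j = i + 1 := h
  rw [Pair.smul_val_eq rfl]
  simp only [Equiv.Perm.mul_apply, adjSwap, Equiv.swap_apply_left]
  rw [Equiv.swap_apply_of_ne_of_ne (a := (⟨i + 1, by omega⟩ : Fin n)), Equiv.swap_apply_left,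
    Equiv.swap_apply_of_ne_of_ne]
  · rfl
  all_goals simp only [ne_eq, Fin.mk.injEq]; omega

theorem simple_adjPair_comm {i j : Fin (n - 1)} (h : Far i j) :
    (pairSystem n).simple (adjPair i) * (pairSystem n).simple (adjPair j)
      = (pairSystem n).simple (adjPair j) * (pairSystem n).simple (adjPair i) := by
  unfold Far at h
  have hd : Disjoint (adjPair i).1 (adjPair j).1 := by
    simp only [adjPair, Finset.disjoint_insert_left, Finset.disjoint_singleton_left,
      Finset.mem_insert, Finset.mem_singleton, Fin.mk.injEq]
    omega
  have hne : adjPair i ≠ adjPair j := by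
    intro e
    rw [e, disjoint_self] at hd
    exact (adjPair j).nonempty.ne_empty hd
  rw [← mul_pow_two_eq_one_iff (CoxeterSystem.simple_mul_simple_self _ _)
    (CoxeterSystem.simple_mul_simple_self _ _)]
  have := (pairSystem n).simple_mul_simple_pow (adjPair i) (adjPair j)
  rwa [pairMatrix_apply, if_neg hne, if_pos hd] at this

theorem simple_adjPair_braid {i j : Fin (n - 1)} (h : Next i j) :
    (pairSystem n).simple (adjPair i) * (pairSystem n).simple (adjPair j)
        * (pairSystem n).simple (adjPair i)
      = (pairSystem n).simple (adjPair j) * (pairSystem n).simple (adjPair i)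
        * (pairSystem n).simple (adjPair j) := by
  unfold Next at h
  have hd : ¬ Disjoint (adjPair i).1 (adjPair j).1 := by
    simp only [adjPair, Finset.disjoint_insert_left, Finset.disjoint_singleton_left,
      Finset.mem_insert, Finset.mem_singleton, Fin.mk.injEq]
    omega
  have hne : adjPair i ≠ adjPair j := by
    intro e
    have : (⟨i, by omega⟩ : Fin n) ∈ (adjPair j).1 := e ▸ Finset.mem_insert_self _ _
    simp only [adjPair, Finset.mem_insert, Finset.mem_singleton, Fin.mk.injEq] at this
    omega
  rw [← mul_pow_three_eq_one_iff (CoxeterSystem.simple_mul_simple_self _ _)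
    (CoxeterSystem.simple_mul_simple_self _ _)]
  have := (pairSystem n).simple_mul_simple_pow (adjPair i) (adjPair j)
  rwa [pairMatrix_apply, if_neg hne, if_neg hd] at this

/-- The images of the generators of `GVB_n` in the semidirect product. -/
noncomputable def semidirectGen (n : ℕ) : Gen n → PairSemidirect n
  | Gen.sigma i => SemidirectProduct.inl ((pairSystem n).simple (adjPair i))
  | Gen.rho i => SemidirectProduct.inr (adjSwap i)

/-- With this rule the relators mixing s and ρ reduce to identities for the action of permutations
on pairs. -/
theorem inr_mul_inl_simple (π : Equiv.Perm (Fin n)) (p : Pair n) :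
    (SemidirectProduct.inr π * SemidirectProduct.inl ((pairSystem n).simple p) :
      PairSemidirect n) =
    SemidirectProduct.inl ((pairSystem n).simple (π • p)) * SemidirectProduct.inr π := by
  rw [← pairAut_simple, SemidirectProduct.inl_aut, mul_assoc, ← map_mul, inv_mul_cancel, map_one,
    mul_one]

theorem semidirectGen_relators (n : ℕ) :
    ∀ w ∈ gaussRelators n, FreeGroup.lift (semidirectGen n) w = 1 := by
  rintro w ((hw | ⟨i, rfl⟩) | ⟨i, rfl⟩)
  · cases hw with
    | sigma_braid i j h =>
      simp only [fs, map_mul, map_inv, FreeGroup.lift_apply_of, semidirectGen, mul_inv_eq_one]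
      simp only [← map_mul, simple_adjPair_braid h]
    | sigma_comm i j h =>
      simp only [fs, map_mul, map_inv, FreeGroup.lift_apply_of, semidirectGen, mul_inv_eq_one]
      simp only [← map_mul, simple_adjPair_comm h]
    | rho_braid i j h =>
      simp only [fr, map_mul, map_inv, FreeGroup.lift_apply_of, semidirectGen, mul_inv_eq_one]
      simp only [← map_mul, adjSwap_braid h]
    | rho_comm i j h =>
      simp only [fr, map_mul, map_inv, FreeGroup.lift_apply_of, semidirectGen, mul_inv_eq_one]
      simp only [← map_mul, adjSwap_comm h]
    | rho_sq i =>
      simp only [fr, map_pow, FreeGroup.lift_apply_of, semidirectGen]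
      rw [← map_pow, pow_two, adjSwap_mul_self, map_one]
    | sigma_rho_comm i j h =>
      simp only [fs, fr, map_mul, map_inv, FreeGroup.lift_apply_of, semidirectGen, mul_inv_eq_one]
      rw [inr_mul_inl_simple, adjSwap_smul_adjPair_of_far h]
    | mixed i j h =>
      simp only [fs, fr, map_mul, map_inv, FreeGroup.lift_apply_of, semidirectGen, mul_inv_eq_one]
      rw [← map_mul, inr_mul_inl_simple, adjSwap_smul_adjSwap_smul_adjPair h, mul_assoc, ← map_mul]
  · simp only [fs, map_pow, FreeGroup.lift_apply_of, semidirectGen]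
    rw [← map_pow, CoxeterSystem.simple_sq, map_one]
  · simp only [fs, fr, map_mul, map_inv, FreeGroup.lift_apply_of, semidirectGen, mul_inv_eq_one]
    rw [inr_mul_inl_simple, adjSwap_smul_adjPair]

/-- The homomorphism from `GVB_n` to the semidirect product. -/
noncomputable def toPairSemidirect (n : ℕ) : GVB n →* PairSemidirect n :=
  PresentedGroup.toGroup (semidirectGen_relators n)

theorem toPairSemidirect_s (i : Fin (n - 1)) : toPairSemidirect n (s i) =
    SemidirectProduct.inl ((pairSystem n).simple (adjPair i)) := PresentedGroup.toGroup.of _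

theorem toPairSemidirect_rho (i : Fin (n - 1)) : toPairSemidirect n (rho i) =
    SemidirectProduct.inr (adjSwap i) := PresentedGroup.toGroup.of _

theorem ofPairSemidirect_comp : (ofPairSemidirect n).comp (toPairSemidirect n) =
    MonoidHom.id _ := by
  refine PresentedGroup.ext fun x => ?_
  cases x with
  | sigma i =>
    change ofPairSemidirect n (toPairSemidirect n (s i)) = s i
    rw [toPairSemidirect_s, ofPairSemidirect, SemidirectProduct.lift_inl, pairHom_simple,
      pairElt_adjPair]
  | rho i =>
    change ofPairSemidirect n (toPairSemidirect n (rho i)) = rho i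
    rw [toPairSemidirect_rho, ofPairSemidirect, SemidirectProduct.lift_inr, iota_adjSwap]

theorem toPairSemidirect_iota (π : Equiv.Perm (Fin n)) :
    toPairSemidirect n (iota n π) = SemidirectProduct.inr π := by
  have : (toPairSemidirect n).comp (iota n) = SemidirectProduct.inr := by
    refine MonoidHom.eq_of_eqOn_denseM (mclosure_range_adjSwap n) ?_
    rintro _ ⟨i, rfl⟩
    simp [iota_adjSwap, toPairSemidirect_rho]
  exact DFunLike.congr_fun this π

theorem toPairSemidirect_comp : (toPairSemidirect n).comp (ofPairSemidirect n) =
    MonoidHom.id _ := by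
  refine SemidirectProduct.hom_ext ((pairSystem n).ext_simple fun p => ?_)
    (MonoidHom.ext fun π => ?_)
  -- Every simple reflection is an S_n-conjugate of one attached to an adjacent pair, the image of
  -- some s_i.
  · obtain ⟨π, i, rfl⟩ := exists_smul_adjPair p
    simp only [MonoidHom.comp_apply, ofPairSemidirect, SemidirectProduct.lift_inl, pairHom_simple,
      MonoidHom.id_apply]
    rw [← iota_conj_pairElt, pairElt_adjPair, map_mul, map_mul, map_inv, toPairSemidirect_iota,
      toPairSemidirect_s, inr_mul_inl_simple, mul_inv_cancel_right]
  · simp only [MonoidHom.comp_apply, ofPairSemidirect, SemidirectProduct.lift_inr,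
      MonoidHom.id_apply, toPairSemidirect_iota]

/-- `GVB_n` is the semidirect product of a Coxeter group and the symmetric group. -/
noncomputable def equivPairSemidirect (n : ℕ) : GVB n ≃* PairSemidirect n :=
  (toPairSemidirect n).toMulEquiv (ofPairSemidirect n) ofPairSemidirect_comp
    toPairSemidirect_comp

/-- It identifies GH_n with the kernel of the projection to S_n, which is the Coxeter factor. -/
theorem right_equivPairSemidirect (g : GVB n) : (equivPairSemidirect n g).right = mu n g := by
  have : SemidirectProduct.rightHom.comp (equivPairSemidirect n).toMonoidHom = mu n := by
    refine PresentedGroup.ext fun x => ?_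
    cases x with
    | sigma i =>
      exact (congrArg SemidirectProduct.right (toPairSemidirect_s i)).trans (mu_s i).symm
    | rho i =>
      exact (congrArg SemidirectProduct.right (toPairSemidirect_rho i)).trans (mu_rho i).symm
  exact DFunLike.congr_fun this g

theorem isFGCoxeter_GH (n : ℕ) : IsFGCoxeter (GH n) := by
  let F : (pairMatrix n).Group →* GH n :=
    ((equivPairSemidirect n).symm.toMonoidHom.comp SemidirectProduct.inl).codRestrict (GH n)
      fun w => by
        rw [MonoidHom.mem_ker, ← right_equivPairSemidirect]
        simp
  have hF (w) : (F w : GVB n) = (equivPairSemidirect n).symm (SemidirectProduct.inl w) := rfl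
  have hbij : Function.Bijective F := by
    refine ⟨fun v w h => ?_, fun g => ⟨(equivPairSemidirect n g).left, Subtype.ext ?_⟩⟩
    · have := congrArg Subtype.val h
      rw [hF, hF] at this
      exact SemidirectProduct.inl_injective ((equivPairSemidirect n).symm.injective this)
    · rw [hF, MulEquiv.symm_apply_eq]
      ext1
      · simp
      · rw [right_equivPairSemidirect, SemidirectProduct.right_inl]
        exact g.2.symm
  exact ⟨Pair n, inferInstance, pairMatrix n, ⟨(pairSystem n).map (MulEquiv.ofBijective F hbij)⟩⟩

/-! ### Linearity of GVB_n. -/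

/-- The Cartan matrix is invariant under S_n, so permuting coordinates carries the reflection of p
to that of π • p. This compatibility extends the geometric representation to the semidirect product.
-/
theorem coroot_permRep (π : Equiv.Perm (Fin n)) (p : Pair n) (v : Pair n → ℚ) :
    coroot (pairMatrix n) (π • p) (permRep _ _ π v) = coroot (pairMatrix n) p v := by
  have : (coroot (pairMatrix n) (π • p)).comp (permRep _ _ π).toLinearMap
      = coroot (pairMatrix n) p := by
    refine LinearMap.pi_ext' fun q => LinearMap.ext_ring ?_
    simp only [LinearMap.comp_apply, LinearMap.single_apply, LinearEquiv.coe_coe, permRep_single,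
      coroot_single, cartan, pairMatrix_smul]
  exact LinearMap.congr_fun this v

/-- The representation of the semidirect product extending the geometric representation. -/
noncomputable def semidirectRep (n : ℕ) :
    PairSemidirect n →* ((Pair n → ℚ) ≃ₗ[ℚ] (Pair n → ℚ)) :=
  SemidirectProduct.lift (geomRep (pairSystem n) pairMatrix_eq_two_or_three) (permRep _ _) fun π =>
    (pairSystem n).ext_simple fun p => by
      simp only [MonoidHom.comp_apply, MulEquiv.coe_toMonoidHom, MulAut.conj_apply,
        pairAut_simple, geomRep_simple]
      rw [eq_mul_inv_iff_mul_eq]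
      ext1 v
      simp only [LinearEquiv.mul_apply, geomReflection, Module.reflection_apply, map_sub, map_smul,
        coroot_permRep, permRep_single]

/-- The extended geometric representation alone need not be faithful: for n = 2 the transposition
fixes the only pair and acts trivially. An element also killed by the permutation representation
lies in ker μ, hence in the Coxeter factor, where the geometric representation is faithful. -/
theorem isLinear_GVB (n : ℕ) : IsLinear (GVB n) := by
  refine isLinear_of_prod ((semidirectRep n).comp (equivPairSemidirect n).toMonoidHom)
    ((permRep (Equiv.Perm (Fin n)) (Fin n)).comp (mu n)) fun g h₁ h₂ => ?_
  have hmu : mu n g = 1 := by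
    refine permRep_injective _ (Fin n) ?_
    rw [map_one]
    exact h₂
  have hg : equivPairSemidirect n g = SemidirectProduct.inl (equivPairSemidirect n g).left := by
    ext1
    · simp
    · rw [right_equivPairSemidirect, hmu, SemidirectProduct.right_inl]
  have h₃ : semidirectRep n (equivPairSemidirect n g) = 1 := h₁
  rw [hg, semidirectRep, SemidirectProduct.lift_inl] at h₃
  have h₄ := geomRep_injective (pairSystem n) pairMatrix_eq_two_or_three (h₃.trans (map_one _).symm)
  rw [h₄, map_one] at hg
  exact (MulEquiv.map_eq_one_iff _).1 hg

theorem finiteIndex_GH (n : ℕ) : (GH n).FiniteIndex :=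
  Subgroup.finiteIndex_ker _

end GaussBraid

theorem mainTheorem12 (n : ℕ) :
    GaussBraid.IsLinear (GaussBraid.GVB n) ∧
    (∃ ι : Equiv.Perm (Fin n) →* GaussBraid.GVB n, GaussBraid.IsSemidirectVia n ι) ∧
    GaussBraid.IsFGCoxeter (GaussBraid.GH n) ∧
    (GaussBraid.GH n).FiniteIndex :=
  ⟨GaussBraid.isLinear_GVB n, ⟨_, GaussBraid.isSemidirectVia_iota n⟩,
    GaussBraid.isFGCoxeter_GH n, GaussBraid.finiteIndex_GH n⟩
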